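/- Let $E$ be a nonreflexive real Banach space with dual $E^*$. A multifunction $S\colon E\rightrightarrows E^*$ assigns to each $x\in E$ a subset $S(x)\subseteq E^*$; its graph is $G(S)=\{(x,x^*): x^*\in S(x)\}$, and $S$ is surjective if $\bigcup_{x\in E}S(x)=E^*$. $S$ is closed if $G(S)$ is closed in $E\times E^*$ (norm topologies); monotone if $\langle s-t,s^*-t^*\rangle\ge 0$ for all $(s,s^*),(t,t^*)\in G(S)$; and quasidense if for all $(x,x^*)\in E\times E^*$ $$\inf_{(s,s^*)\in G(S)}\Big[\tfrac12\|s-x\|^2+\tfrac12\|s^*-x^*\|^2+\langle s-x,s^*-x^*\rangle\Big]\le 0 .$$ Sums of multifunctions are pointwise Minkowski sums, ${}_xS$ denotes the translate ${}_xS(t)=S(t+x)$, and $J\colon E\rightrightarrows E^*$ is the duality map $J(x)=\{x^*\in E^*:\|x\|^2=\|x^*\|^2=\langle x,x^*\rangle\}$. Let $0$ denote the multifunction $x\mapsto\{0\}$. Then: 1. $J$ is not surjective. 2. For every $x\in E$, ${}_x0=0$, and ${}_x0+J$ is not surjective. 3. The multifunction $0$ is closed, monotone and quasidense. 4. Consequently,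 the implication "if $S\colon E\rightrightarrows E^*$ has nonempty graph and is closed, monotone and quasidense, then ${}_xS+J$ is surjective for all $x\in E$" fails on $E$. -/

import Mathlib

open scoped Pointwise

/-- A multifunction `E ⇉ E*`: to each point of `E` it assigns a (possibly empty) subset of the
dual. -/
abbrev Multifunction (E : Type*) [NormedAddCommGroup E] [NormedSpace ℝ E] :=
  E → Set (StrongDual ℝ E)

namespace Multifunction

section

variable {E : Type*} [NormedAddCommGroup E] [NormedSpace ℝ E]

/-- The graph `G(S) ⊆ E × E*`. -/
def graph (S : Multifunction E) : Set (E × StrongDual ℝ E) :=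
  {p | p.2 ∈ S p.1}

/-- The range `R(S) = ⋃ x, S x ⊆ E*`. -/
def range (S : Multifunction E) : Set (StrongDual ℝ E) :=
  {y | ∃ x, y ∈ S x}

/-- `S` is surjective if `R(S) = E*`. -/
def IsSurjective (S : Multifunction E) : Prop :=
  S.range = Set.univ

/-- `S` is closed if its graph is closed in `E × E*` (for the norm topologies). -/
def HasClosedGraph (S : Multifunction E) : Prop :=
  IsClosed S.graph

/-- `S` is monotone if `⟨s - t, s* - t*⟩ ≥ 0` for all `(s, s*)` and `(t, t*)` in `G(S)`. -/
def IsMonotone (S : Multifunction E) : Prop :=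
  ∀ p ∈ S.graph, ∀ q ∈ S.graph, 0 ≤ (p.2 - q.2) (p.1 - q.1)

/-- `S` is quasidense if, for every `(x, x*)`, the infimum over `(s, s*) ∈ G(S)` of
`½‖s - x‖² + ½‖s* - x*‖² + ⟨s - x, s* - x*⟩` is at most `0`.  The infimum is taken in the extended
reals, so that it is `+∞` (and the condition fails) if the graph is empty. -/
def IsQuasidense (S : Multifunction E) : Prop :=
  ∀ (x : E) (y : StrongDual ℝ E),
    (⨅ p ∈ S.graph, (((1 / 2 : ℝ) * ‖p.1 - x‖ ^ 2 + (1 / 2 : ℝ) * ‖p.2 - y‖ ^ 2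
      + (p.2 - y) (p.1 - x) : ℝ) : EReal)) ≤ 0

/-- The inverse `S⁻¹ : E* ⇉ E`, with `S⁻¹(y) = {x | y ∈ S x}`. -/
def inverse (S : Multifunction E) (y : StrongDual ℝ E) : Set E :=
  {x | y ∈ S x}

/-- The translate `ₓS = (S⁻¹ - x)⁻¹`, that is, `ₓS(t) = S(t + x)`. -/
def translate (x : E) (S : Multifunction E) : Multifunction E :=
  fun t => S (t + x)

theorem inverse_translate (x : E) (S : Multifunction E) (y : StrongDual ℝ E) :
    (S.translate x).inverse y = (fun s => s - x) '' S.inverse y := by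
  ext t
  constructor
  · intro h
    exact ⟨t + x, h, by simp⟩
  · rintro ⟨s, hs, rfl⟩
    simpa [inverse, translate] using hs

/-- The pointwise (Minkowski) sum `(S + T)(x) = {s* + t* | s* ∈ S x, t* ∈ T x}`. -/
def sum (S T : Multifunction E) : Multifunction E :=
  fun x => S x + T x

variable (E)

/-- The multifunction `0`, with `0(x) = {0}` for all `x`. -/
def zeroMap : Multifunction E :=
  fun _ => {0}

/-- The duality map `J x = {x* | ‖x‖² = ‖x*‖² = ⟨x, x*⟩}`. -/
def dualityMap : Multifunction E :=
  fun x => {y | ‖x‖ ^ 2 = ‖y‖ ^ 2 ∧ ‖y‖ ^ 2 = y x}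

variable {E}

theorem mem_dualityMap_iff (x : E) (y : StrongDual ℝ E) :
    y ∈ dualityMap E x ↔ (1 / 2 : ℝ) * ‖x‖ ^ 2 + (1 / 2 : ℝ) * ‖y‖ ^ 2 = y x := by
  constructor
  · rintro ⟨h1, h2⟩
    linarith
  · intro h
    have h1 : y x ≤ ‖y‖ * ‖x‖ := (le_abs_self _).trans (y.le_opNorm x)
    have h2 : ‖x‖ = ‖y‖ := by nlinarith [sq_nonneg (‖x‖ - ‖y‖)]
    refine ⟨by rw [h2], ?_⟩
    rw [h2] at h
    linarith

end

end Multifunction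

/-- A real normed space is reflexive if the canonical embedding into its bidual is onto. -/
def IsReflexiveSpace (E : Type*) [NormedAddCommGroup E] [NormedSpace ℝ E] : Prop :=
  Function.Surjective (NormedSpace.inclusionInDoubleDual ℝ E)

/-! ### Norming vectors, Goldstine, annihilators, Riesz -/

section NormApproximation

variable {E : Type*} [NormedAddCommGroup E] [NormedSpace ℝ E]

/-! If `y ∈ J x`, then `y` attains its norm on the unit ball, so surjectivity of `J` would
contradict James' theorem. Adding the translation-invariant map `0` changes nothing. Yet `0` is
quasidense, since that only asks for near-attainment: with `‖z‖ ≤ ‖y‖` and `y z ≥ ‖y‖² - ε`, the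
point `(x + z, 0)` gives a value at most `ε`.

James' theorem is proved in three steps. Nonreflexivity yields bounded `f n`, `x n` with a
triangular pattern that keeps convex combinations of the `f n` at distance at least `1/2` from their
cluster functionals. Pryce's argument thins the sequence until all cluster functionals are
equidistant from each point of its closed span. Finally, the series from the proof of Simons'
inequality produces `u` and a cluster functional `w` such that `u - w` does not attain its norm. -/

theorem StrongDual.exists_lt_apply_of_lt_norm (y : StrongDual ℝ E) {r : ℝ} (h : r < ‖y‖) :
    ∃ x : E, ‖x‖ ≤ 1 ∧ r < y x := by
  obtain ⟨x, hx, hr⟩ := y.exists_lt_apply_of_lt_opNorm h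
  rcases le_total 0 (y x) with h0 | h0
  · exact ⟨x, hx.le, by rwa [Real.norm_of_nonneg h0] at hr⟩
  · exact ⟨-x, by simpa using hx.le, by simpa [Real.norm_of_nonpos h0] using hr⟩

theorem StrongDual.apply_le_norm (y : StrongDual ℝ E) {x : E} (hx : ‖x‖ ≤ 1) : y x ≤ ‖y‖ :=
  (le_abs_self _).trans (y.unit_le_opNorm x hx)

/-- A finite form of Goldstine's theorem. -/
theorem exists_unit_forall_lt_apply (F : StrongDual ℝ (StrongDual ℝ E)) (hF : ‖F‖ ≤ 1) {θ : ℝ}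
    (s : Finset (StrongDual ℝ E)) (hs : ∀ f ∈ s, θ < F f) :
    ∃ x : E, ‖x‖ ≤ 1 ∧ ∀ f ∈ s, θ < f x := by
  classical
  let L : E →ₗ[ℝ] (s → ℝ) := LinearMap.pi fun f => (f : StrongDual ℝ E).toLinearMap
  let K : Set (s → ℝ) := L '' Metric.closedBall 0 1
  have hK : Convex ℝ K := (convex_closedBall 0 1).linear_image L
  let p : s → ℝ := fun f => F f
  by_cases hp : p ∈ closure K
  · have hU : IsOpen {v : s → ℝ | ∀ f, θ < v f} := by
      simp only [Set.ofPred_forall]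
      exact isOpen_iInter_of_finite fun f => isOpen_lt continuous_const (continuous_apply f)
    obtain ⟨v, hv, x, hx, rfl⟩ := mem_closure_iff.1 hp _ hU fun f => hs f f.2
    exact ⟨x, by simpa using hx, fun f hf => hv ⟨f, hf⟩⟩
  · obtain ⟨φ, u, hφ, hu⟩ := geometric_hahn_banach_closed_point hK.closure isClosed_closure hp
    -- The separating functional pulls back to `y` in the span of `s`: it stays below `u` on the
    -- unit ball while `F y > u`, against `‖F‖ ≤ 1`.
    let y : StrongDual ℝ E := ∑ f : s, φ (fun g => if f = g then 1 else 0) • (f : StrongDual ℝ E)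
    have hφe : ∀ v : s → ℝ, φ v = ∑ f, v f * φ (fun g => if f = g then 1 else 0) := fun v =>
      φ.toLinearMap.pi_apply_eq_sum_univ v
    have hFy : F y = φ p := by
      rw [hφe, map_sum]
      exact Finset.sum_congr rfl fun f _ => by rw [map_smul, smul_eq_mul, mul_comm]
    have hy : ∀ x, y x = φ (L x) := fun x => by
      rw [hφe, sum_apply]
      exact Finset.sum_congr rfl fun f _ => mul_comm _ _
    have hle : F y ≤ ‖y‖ := (le_abs_self _).trans
      ((F.le_opNorm y).trans (mul_le_of_le_one_left (norm_nonneg y) hF))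
    obtain ⟨x, hx, hux⟩ := y.exists_lt_apply_of_lt_norm (r := u) (by linarith)
    have := hφ (L x) (subset_closure ⟨x, by simpa using hx, rfl⟩)
    rw [hy] at hux
    exact absurd this hux.not_gt

/-- Duality between distance to a span and norm on its annihilator: if `G` is a Hahn–Banach
extension of `F` restricted to the common kernel, then `F - G` vanishes there, hence lies in the
span, and its distance to `F` is the norm of the restriction. -/
theorem exists_unit_annihilator_lt_apply (F : StrongDual ℝ E) {θ : ℝ}
    (s : Finset (StrongDual ℝ E))
    (hθ : ∀ G ∈ Submodule.span ℝ (s : Set (StrongDual ℝ E)), θ < ‖F - G‖) :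
    ∃ x : E, ‖x‖ ≤ 1 ∧ (∀ g ∈ s, g x = 0) ∧ θ < F x := by
  let L : s → E →ₗ[ℝ] ℝ := fun g => (g : StrongDual ℝ E).toLinearMap
  let M : Submodule ℝ E := ⨅ g, (L g).ker
  have hM : ∀ x : E, x ∈ M ↔ ∀ g ∈ s, g x = 0 := fun x => by
    simp [M, L, Submodule.mem_iInf]
  obtain ⟨G, hGF, hG⟩ := exists_extension_norm_eq M (F.comp M.subtypeL)
  have hker : M ≤ (F - G).toLinearMap.ker := fun x hx => by
    have : G x = F x := hGF ⟨x, hx⟩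
    simp [this]
  have hspan := mem_span_of_iInf_ker_le_ker hker
  have hrange : Submodule.span ℝ (Set.range L) ≤
      (Submodule.span ℝ (s : Set (StrongDual ℝ E))).map (ContinuousLinearMap.coeLM ℝ) := by
    rw [Submodule.span_le]
    rintro _ ⟨g, rfl⟩
    exact ⟨g, Submodule.subset_span g.2, rfl⟩
  obtain ⟨H, hH, hHFG⟩ := hrange hspan
  obtain rfl : H = F - G := ContinuousLinearMap.coe_injective hHFG
  have hlt := hθ _ hH
  rw [sub_sub_cancel, hG] at hlt
  obtain ⟨x, hx, hxF⟩ := StrongDual.exists_lt_apply_of_lt_norm (F.comp M.subtypeL) hlt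
  exact ⟨x, hx, (hM x).1 x.2, hxF⟩

theorem exists_unit_forall_lt_norm_sub {V : Submodule ℝ E} (hV : IsClosed (V : Set E))
    (h : ∃ x, x ∉ V) : ∃ x : E, ‖x‖ ≤ 1 ∧ ∀ v ∈ V, 1 / 2 < ‖x - v‖ := by
  obtain ⟨x, hx, hxV⟩ := riesz_lemma hV h (r := 3 / 4) (by norm_num)
  have hx0 : x ≠ 0 := fun h0 => hx (h0 ▸ V.zero_mem)
  have hn : 0 < ‖x‖ := norm_pos_iff.2 hx0
  refine ⟨‖x‖⁻¹ • x, by rw [norm_smul, norm_inv, norm_norm, inv_mul_cancel₀ hn.ne'],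
    fun v hv => ?_⟩
  have h1 := hxV _ (V.smul_mem ‖x‖ hv)
  have h2 : x - ‖x‖ • v = ‖x‖ • (‖x‖⁻¹ • x - v) := by rw [smul_sub, smul_inv_smul₀ hn.ne']
  rw [h2, norm_smul, norm_norm, mul_comm, mul_le_mul_iff_right₀ hn] at h1
  linarith

end NormApproximation

/-! ### A triangular system from nonreflexivity -/

section JamesSequence

variable {E : Type*} [NormedAddCommGroup E] [NormedSpace ℝ E] [CompleteSpace E]

/-- Fix `F` in the unit ball of the bidual, more than `1/2` away from the image of `E`. Recursively,
`f n` kills the earlier `x m` and keeps `F (f n) > 1/2`, while `x n` imitates `F` on the earlier `f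
m`. Nothing is required of `f n (x n)`. -/
theorem exists_biorthogonal_seq_of_not_reflexive (hE : ¬ IsReflexiveSpace E) :
    ∃ (f : ℕ → StrongDual ℝ E) (x : ℕ → E), (∀ n, ‖f n‖ ≤ 1) ∧ (∀ n, ‖x n‖ ≤ 1) ∧
      (∀ m n, m < n → 1 / 2 < f m (x n)) ∧ ∀ m n, m < n → f n (x m) = 0 := by
  classical
  obtain ⟨F₀, hF₀⟩ := not_forall.1 hE
  let V := LinearMap.range (NormedSpace.inclusionInDoubleDual ℝ E).toLinearMap
  have hV : IsClosed (V : Set (StrongDual ℝ (StrongDual ℝ E))) :=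
    (NormedSpace.inclusionInDoubleDualLi ℝ
      (E := E)).isometry.isUniformInducing.isComplete_range.isClosed
  obtain ⟨F, hF1, hF⟩ := exists_unit_forall_lt_norm_sub
    (E := StrongDual ℝ (StrongDual ℝ E)) hV ⟨F₀, hF₀⟩
  obtain ⟨g, hg, hgr⟩ := exists_seq_of_forall_finset_exists
    (fun p : StrongDual ℝ E × E => ‖p.1‖ ≤ 1 ∧ ‖p.2‖ ≤ 1 ∧ 1 / 2 < F p.1)
    (fun p q => 1 / 2 < p.1 q.2 ∧ q.1 p.2 = 0) (fun s hs => by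
      have hsV : Submodule.span ℝ ((s.image fun p => NormedSpace.inclusionInDoubleDual ℝ E p.2 :
          Finset _) : Set (StrongDual ℝ (StrongDual ℝ E))) ≤ V := by
        rw [Submodule.span_le]
        intro G hG
        obtain ⟨p, -, rfl⟩ := Finset.mem_image.1 (Finset.mem_coe.1 hG)
        exact ⟨p.2, rfl⟩
      obtain ⟨f, hf1, hf0, hfF⟩ := exists_unit_annihilator_lt_apply F _ fun G hG => hF G (hsV hG)
      obtain ⟨x, hx1, hx⟩ := exists_unit_forall_lt_apply F hF1 (s.image Prod.fst)
        (fun f hf => by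
          obtain ⟨p, hp, rfl⟩ := Finset.mem_image.1 hf
          exact (hs p hp).2.2)
      exact ⟨(f, x), ⟨hf1, hx1, hfF⟩, fun p hp =>
        ⟨hx _ (Finset.mem_image_of_mem _ hp), hf0 _ (Finset.mem_image_of_mem _ hp)⟩⟩)
  exact ⟨fun n => (g n).1, fun n => (g n).2,
    fun n => (hg n).1, fun n => (hg n).2.1, fun m n h => (hgr m n h).1, fun m n h => (hgr m n h).2⟩

end JamesSequence

/-! ### Cluster functionals and Pryce's subsequence -/

section ClusterFunctionals

open Filter Topology

variable {E ι : Type*} [NormedAddCommGroup E] [NormedSpace ℝ E]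

/-- The functionals lying pointwise between the lower and the upper limit of `f` along `l`. -/
def clusterFunctionals (l : Filter ι) (f : ι → StrongDual ℝ E) : Set (StrongDual ℝ E) :=
  {w | ∀ x c, (∀ᶠ i in l, f i x ≤ c) → w x ≤ c}

theorem clusterFunctionals_mono {l l' : Filter ι} (h : l ≤ l') (f : ι → StrongDual ℝ E) :
    clusterFunctionals l f ⊆ clusterFunctionals l' f :=
  fun _ hw x c hc => hw x c (h hc)

theorem le_apply_of_mem_clusterFunctionals {l : Filter ι} {f : ι → StrongDual ℝ E}
    {w : StrongDual ℝ E} (hw : w ∈ clusterFunctionals l f) {x : E} {c : ℝ}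
    (h : ∀ᶠ i in l, c ≤ f i x) : c ≤ w x := by
  have := hw (-x) (-c) (h.mono fun i hi => by simpa using hi)
  simpa using this

theorem norm_le_of_mem_clusterFunctionals {l : Filter ι} {f : ι → StrongDual ℝ E}
    (hf : ∀ i, ‖f i‖ ≤ 1) {w : StrongDual ℝ E} (hw : w ∈ clusterFunctionals l f) : ‖w‖ ≤ 1 := by
  by_contra! h
  obtain ⟨x, hx, h1⟩ := w.exists_lt_apply_of_lt_norm h
  exact (hw x 1 (.of_forall fun i => ((f i).apply_le_norm hx).trans (hf i))).not_gt h1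

/-- Banach–Alaoglu: any weak* cluster point of `f` will do. -/
theorem clusterFunctionals_nonempty {l : Filter ι} [l.NeBot] {f : ι → StrongDual ℝ E}
    (hf : ∀ i, ‖f i‖ ≤ 1) : (clusterFunctionals l f).Nonempty := by
  obtain ⟨w, -, hw⟩ := (WeakDual.isCompact_closedBall (𝕜 := ℝ) (E := E) 0 1).exists_mapClusterPt
    (f := l) (u := fun i => StrongDual.toWeakDual (f i))
    (by
      rw [le_principal_iff, mem_map]
      exact univ_mem' fun i => by simpa using hf i)
  refine ⟨WeakDual.toStrongDual w, fun x c hc => ?_⟩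
  have hx : MapClusterPt (w x) l (fun i => f i x) :=
    hw.continuousAt_comp (f := fun y : WeakDual ℝ E => y x) (WeakDual.eval_continuous x).continuousAt
  by_contra! hlt
  obtain ⟨i, hi, hic⟩ := ((hx.frequently (Ioi_mem_nhds hlt)).and_eventually hc).exists
  exact hic.not_gt hi

/-- Take `w` nearly farthest from `h` and a unit-ball vector `x` nearly norming `h - w`. Keeping
only indices with `f i x ≤ w x + ε / 2` forces every surviving functional to be nearly as far from
`h`. Countable generation is preserved so that a sequence can be extracted at the end. -/
theorem exists_le_norm_sub_le_add {l : Filter ι} [l.NeBot] [l.IsCountablyGenerated]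
    {f : ι → StrongDual ℝ E} (hf : ∀ i, ‖f i‖ ≤ 1) (h : StrongDual ℝ E) {ε : ℝ} (hε : 0 < ε) :
    ∃ l' ≤ l, l'.NeBot ∧ l'.IsCountablyGenerated ∧
      ∀ w ∈ clusterFunctionals l' f, ∀ w' ∈ clusterFunctionals l' f, ‖h - w‖ ≤ ‖h - w'‖ + ε := by
  let T := (fun w => ‖h - w‖) '' clusterFunctionals l f
  have hT : BddAbove T := ⟨‖h‖ + 1, by
    rintro _ ⟨w, hw, rfl⟩
    exact (norm_sub_le _ _).trans (by gcongr; exact norm_le_of_mem_clusterFunctionals hf hw)⟩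
  obtain ⟨_, ⟨w, hw, rfl⟩, hwT⟩ := exists_lt_of_lt_csSup
    ((clusterFunctionals_nonempty (l := l) hf).image _) (sub_lt_self (sSup T) (half_pos hε))
  obtain ⟨x, hx, hxw⟩ := (h - w).exists_lt_apply_of_lt_norm hwT
  refine ⟨l ⊓ 𝓟 {i | f i x ≤ w x + ε / 2}, inf_le_left, ?_, inferInstance, fun v hv v' hv' => ?_⟩
  -- Were these indices not frequent, `w x` would be at least `w x + ε / 2`.
  · refine frequently_mem_iff_neBot.1 fun hn => ?_
    have := le_apply_of_mem_clusterFunctionals (c := w x + ε / 2) hw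
      (hn.mono fun i hi => (not_le.1 hi).le)
    linarith
  · have h1 : ‖h - v‖ ≤ sSup T :=
      le_csSup hT ⟨v, clusterFunctionals_mono inf_le_left f hv, rfl⟩
    have h2 : v' x ≤ w x + ε / 2 := hv' x _ (mem_inf_of_right (mem_principal_self _))
    have h3 := (h - v').apply_le_norm hx
    simp only [sub_apply] at h3 hxw
    linarith

/-- Pryce's diagonal argument. -/
theorem exists_subseq_norm_sub_eq {f : ℕ → StrongDual ℝ E} (hf : ∀ n, ‖f n‖ ≤ 1) :
    ∃ φ : ℕ → ℕ, Tendsto φ atTop atTop ∧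
      ∀ h ∈ closure (Submodule.span ℝ (Set.range f) : Set (StrongDual ℝ E)),
        ∀ w ∈ clusterFunctionals atTop (f ∘ φ), ∀ w' ∈ clusterFunctionals atTop (f ∘ φ),
          ‖h - w‖ = ‖h - w'‖ := by
  have hsep : TopologicalSpace.IsSeparable
      (Submodule.span ℝ (Set.range f) : Set (StrongDual ℝ E)) :=
    (Set.countable_range f).isSeparable.span
  obtain ⟨c, hc, hcd⟩ := hsep
  obtain ⟨e, he⟩ := (hc.insert 0).exists_eq_range (Set.insert_nonempty _ _)
  let Φ := {l : Filter ℕ // l ≤ atTop ∧ l.NeBot ∧ l.IsCountablyGenerated}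
  -- Through `Nat.unpair`, every dense point `e i` is treated with every tolerance `1 / (n + 1)`.
  have step : ∀ (k : ℕ) (l : Φ), ∃ l' : Φ, l'.1 ≤ l.1 ∧
      ∀ w ∈ clusterFunctionals l'.1 f, ∀ w' ∈ clusterFunctionals l'.1 f,
        ‖e k.unpair.1 - w‖ ≤ ‖e k.unpair.1 - w'‖ + 1 / ((k.unpair.2 : ℝ) + 1) := by
    rintro k ⟨l, hl, hl1, hl2⟩
    obtain ⟨l', h1, h2, h3, h4⟩ := exists_le_norm_sub_le_add (l := l) hf (e k.unpair.1)
      (Nat.one_div_pos_of_nat (n := k.unpair.2))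
    exact ⟨⟨l', h1.trans hl, h2, h3⟩, h1, h4⟩
  choose N hN hN' using step
  let l : ℕ → Φ := fun k => Nat.rec ⟨atTop, le_rfl, inferInstance, inferInstance⟩ N k
  have hl : Antitone fun k => (l k).1 := antitone_nat_of_succ_le fun k => hN k (l k)
  have : (⨅ k, (l k).1).NeBot :=
    iInf_neBot_of_directed (directed_of_isDirected_le hl) fun k => (l k).2.2.1
  have : ∀ k, (l k).1.IsCountablyGenerated := fun k => (l k).2.2.2
  -- The diagonal sequence: it is eventually in every set of every refined filter.
  obtain ⟨φ, hφ⟩ := exists_seq_tendsto (⨅ k, (l k).1)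
  refine ⟨φ, hφ.mono_right (iInf_le_of_le 0 le_rfl), ?_⟩
  have hsub : ∀ k, clusterFunctionals atTop (f ∘ φ) ⊆ clusterFunctionals (l k).1 f :=
    fun k w hw x c hx => hw x c (hφ ((iInf_le (fun k => (l k).1) k) hx))
  have key : ∀ w ∈ clusterFunctionals atTop (f ∘ φ), ∀ w' ∈ clusterFunctionals atTop (f ∘ φ),
      ∀ k, ‖e k - w‖ ≤ ‖e k - w'‖ := by
    intro w hw w' hw' k
    refine le_of_forall_pos_le_add fun ε hε => ?_
    obtain ⟨n, hn⟩ := exists_nat_one_div_lt hε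
    have := hN' (Nat.pair k n) (l _) w (hsub (Nat.pair k n + 1) hw) w'
      (hsub (Nat.pair k n + 1) hw')
    simp only [Nat.unpair_pair] at this
    linarith
  intro h hh w hw w' hw'
  have hcl : h ∈ closure (Set.range e) := by
    rw [← he]
    exact closure_mono (Set.subset_insert _ _) (closure_minimal hcd isClosed_closure hh)
  have hclosed : IsClosed {h | ‖h - w‖ = ‖h - w'‖} :=
    isClosed_eq (by fun_prop) (by fun_prop)
  refine closure_minimal ?_ hclosed hcl
  rintro _ ⟨k, rfl⟩
  exact le_antisymm (key w hw w' hw' k) (key w' hw' w hw k)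

end ClusterFunctionals

/-! ### Simons' construction and James' theorem -/

section James

open Filter Topology

variable {E : Type*} [NormedAddCommGroup E] [NormedSpace ℝ E]

theorem Set.Nonempty.exists_forall_le_add {α : Type*} {C : Set α} (hC : C.Nonempty) {Φ : α → ℝ}
    (hΦ : ∀ a, 0 ≤ Φ a) {ε : ℝ} (hε : 0 < ε) : ∃ a ∈ C, ∀ b ∈ C, Φ a ≤ Φ b + ε := by
  obtain ⟨_, ⟨a, ha, rfl⟩, hlt⟩ := exists_lt_of_csInf_lt (hC.image Φ)
    (lt_add_of_pos_right (sInf (Φ '' C)) hε)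
  refine ⟨a, ha, fun b hb => hlt.le.trans ?_⟩
  gcongr
  exact csInf_le ⟨0, by rintro _ ⟨c, -, rfl⟩; exact hΦ c⟩ ⟨b, hb, rfl⟩

theorem clusterFunctionals_convexHull_subset {f g : ℕ → StrongDual ℝ E}
    (hg : ∀ n, g n ∈ convexHull ℝ (f '' Set.Ici n)) :
    clusterFunctionals atTop g ⊆ clusterFunctionals atTop f := by
  intro w hw x c hc
  obtain ⟨N, hN⟩ := eventually_atTop.1 hc
  refine hw x c (eventually_atTop.2 ⟨N, fun n hn => ?_⟩)
  have hconv : Convex ℝ {y : StrongDual ℝ E | y x ≤ c} := by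
    intro y hy z hz a b ha hb hab
    simp only [Set.mem_ofPred_eq, add_apply, smul_apply, smul_eq_mul] at hy hz ⊢
    calc a * y x + b * z x ≤ a * c + b * c := by gcongr
      _ = c := by rw [← add_mul, hab, one_mul]
  refine convexHull_min ?_ hconv (hg n)
  rintro _ ⟨k, hk, rfl⟩
  exact hN k (hn.trans hk)

/-- The choice made in the proof of Simons' inequality: a geometric series of convex combinations
of the tails of `f` whose partial sums nearly minimize the distance to `w₀`. -/
theorem exists_nearly_minimizing_series {f : ℕ → StrongDual ℝ E} (hf : ∀ n, ‖f n‖ ≤ 1)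
    (w₀ : StrongDual ℝ E) {q : ℝ} (hq0 : 0 < q) (hq1 : q < 1) {ε : ℕ → ℝ} (hε : ∀ n, 0 < ε n) :
    ∃ (g S : ℕ → StrongDual ℝ E) (u : StrongDual ℝ E),
      (∀ n, g n ∈ convexHull ℝ (f '' Set.Ici n)) ∧ S 0 = 0 ∧
      (∀ n, S (n + 1) = S n + ((1 - q) * q ^ n) • g n) ∧
      (∀ n, S n + q ^ n • g n ∈ convexHull ℝ (Set.range f)) ∧
      u ∈ closure (convexHull ℝ (Set.range f)) ∧ (∀ n, ‖u - S n‖ ≤ q ^ n) ∧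
      ∀ n, ‖S n + q ^ n • g n - w₀‖ ≤ ‖u - w₀‖ + ε n := by
  let C : ℕ → Set (StrongDual ℝ E) := fun n => convexHull ℝ (f '' Set.Ici n)
  have hCne : ∀ n, (C n).Nonempty := fun n => (Set.nonempty_Ici.image f).convexHull
  have hCmono : ∀ {m n}, m ≤ n → C n ⊆ C m := fun h =>
    convexHull_mono (Set.image_mono (Set.Ici_subset_Ici.2 h))
  have hC1 : ∀ n, ∀ y ∈ C n, ‖y‖ ≤ 1 := fun n y hy => by
    have : C n ⊆ Metric.closedBall 0 1 := convexHull_min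
      (by rintro _ ⟨k, -, rfl⟩; simpa using hf k) (convex_closedBall 0 1)
    simpa using this hy
  choose G hGC hG using fun (n : ℕ) (s : StrongDual ℝ E) =>
    (hCne n).exists_forall_le_add (Φ := fun y => ‖s + q ^ n • y - w₀‖) (fun _ => norm_nonneg _)
      (hε n)
  let S : ℕ → StrongDual ℝ E := fun n => Nat.rec 0 (fun n s => s + ((1 - q) * q ^ n) • G n s) n
  let g : ℕ → StrongDual ℝ E := fun n => G n (S n)
  have hg : ∀ n, g n ∈ C n := fun n => hGC n (S n)
  have hS : ∀ n, S (n + 1) = S n + ((1 - q) * q ^ n) • g n := fun n => rfl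
  -- The weights `(1 - q) q ^ j` for `n ≤ j < n + k`, together with `q ^ (n + k)`, sum to `q ^ n`.
  -- Hence later stages, and `u` in the limit, compete in the minimization at stage `n`.
  have htail : ∀ n k, ∀ z ∈ C (n + k), ∃ y ∈ C n, S (n + k) + q ^ (n + k) • z = S n + q ^ n • y := by
    intro n k
    induction k with
    | zero => exact fun z hz => ⟨z, hz, rfl⟩
    | succ k ih =>
      intro z hz
      obtain ⟨y, hy, h⟩ := ih ((1 - q) • g (n + k) + q • z)
        ((convex_convexHull ℝ _) (hg _) (hCmono (by omega) hz) (by linarith) hq0.le (by ring))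
      refine ⟨y, hy, ?_⟩
      rw [← h, ← add_assoc n k 1, hS]
      module
  have hcauchy : CauchySeq S := cauchySeq_of_le_geometric q 1 hq1 fun n => by
    rw [dist_comm, dist_eq_norm, hS, add_sub_cancel_left, norm_smul, one_mul,
      Real.norm_of_nonneg (mul_nonneg (by linarith) (by positivity))]
    have : 0 < q ^ n := by positivity
    calc (1 - q) * q ^ n * ‖g n‖ ≤ 1 * q ^ n * 1 := by
          gcongr
          · linarith
          · exact hC1 n _ (hg n)
      _ = q ^ n := by ring
  obtain ⟨u, hu⟩ := cauchySeq_tendsto_of_complete hcauchy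
  let T : ℕ → StrongDual ℝ E := fun m => S m + q ^ m • g m
  have hT : Tendsto T atTop (𝓝 u) := by
    have h0 : Tendsto (fun m => q ^ m • g m) atTop (𝓝 0) := by
      refine squeeze_zero_norm (fun m => ?_) (tendsto_pow_atTop_nhds_zero_of_lt_one hq0.le hq1)
      rw [norm_smul, Real.norm_of_nonneg (by positivity)]
      exact mul_le_of_le_one_right (by positivity) (hC1 m _ (hg m))
    simpa using hu.add h0
  have hTn : ∀ n, ∀ᶠ m in atTop, ∃ y ∈ C n, T m = S n + q ^ n • y := fun n => by
    filter_upwards [eventually_ge_atTop n] with m hm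
    obtain ⟨k, rfl⟩ := Nat.exists_eq_add_of_le hm
    exact htail n k _ (hg _)
  have hT0 : ∀ n, T n ∈ convexHull ℝ (Set.range f) := fun n => by
    obtain ⟨y, hy, h⟩ := htail 0 n (g (0 + n)) (hg _)
    have h' : T (0 + n) = y := by simpa [S] using h
    rw [zero_add] at h'
    rw [h']
    exact convexHull_mono (Set.image_subset_range _ _) hy
  refine ⟨g, S, u, hg, rfl, hS, hT0, mem_closure_of_tendsto hT (.of_forall hT0), fun n => ?_,
    fun n => ?_⟩
  · refine le_of_tendsto ((hT.sub_const (S n)).norm) ((hTn n).mono ?_)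
    rintro m ⟨y, hy, h⟩
    rw [h, add_sub_cancel_left, norm_smul, Real.norm_of_nonneg (by positivity)]
    exact mul_le_of_le_one_right (by positivity) (hC1 n y hy)
  · refine ge_of_tendsto (((hT.sub_const w₀).norm).add_const (ε n)) ((hTn n).mono ?_)
    rintro m ⟨y, hy, h⟩
    rw [h]
    exact hG n (S n) y hy

/-- The series must be built from `w₀`, before the cluster functional `w` of `g` exists;
equidistance then replaces `w₀` by `w`. If `u - w` attained its norm at `x`, near-minimality would
bound each `g n x` from above and so keep the remainders `D n` large. But `D (n + 1)` is small
against `D n`, so `g n x` exceeds `w x` by `θ / 2` for all `n`, which is impossible for a cluster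
functional. -/
theorem exists_forall_apply_ne_norm {f : ℕ → StrongDual ℝ E} (hf : ∀ n, ‖f n‖ ≤ 1) {θ : ℝ}
    (hθ0 : 0 < θ) (hθ1 : θ ≤ 1)
    (hdist : ∀ h ∈ convexHull ℝ (Set.range f), ∀ w ∈ clusterFunctionals atTop f, θ ≤ ‖h - w‖)
    (heq : ∀ h ∈ closure (convexHull ℝ (Set.range f)), ∀ w ∈ clusterFunctionals atTop f,
      ∀ w' ∈ clusterFunctionals atTop f, ‖h - w‖ = ‖h - w'‖) :
    ∃ y : StrongDual ℝ E, ∀ x, ‖x‖ ≤ 1 → y x ≠ ‖y‖ := by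
  obtain ⟨w₀, hw₀⟩ := clusterFunctionals_nonempty (l := atTop) hf
  -- Chosen so that `2 * q ^ (n + 1) = θ / 4 * q ^ n`; the errors `ε n / q ^ (n + 1)` sum to `θ /
  -- 4`, leaving `D n ≥ 3 / 4 * θ * q ^ n`.
  set q : ℝ := θ / 8 with hq
  have hq0 : 0 < q := by positivity
  have hq1 : q < 1 := by linarith
  let ε : ℕ → ℝ := fun n => θ / 4 * q ^ (n + 1) * (1 / 2) ^ (n + 1)
  obtain ⟨g, S, u, hg, hS0, hS, hT, hu, huS, hmin⟩ :=
    exists_nearly_minimizing_series hf w₀ hq0 hq1 (ε := ε) fun n => by positivity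
  have hg1 : ∀ n, ‖g n‖ ≤ 1 := fun n => by
    have := convexHull_min (t := Metric.closedBall 0 1)
      (by rintro _ ⟨k, -, rfl⟩; simpa using hf k) (convex_closedBall 0 1) (hg n)
    simpa using this
  obtain ⟨w, hwg⟩ := clusterFunctionals_nonempty (l := atTop) hg1
  have hw := clusterFunctionals_convexHull_subset hg hwg
  refine ⟨u - w, fun x hx hux => ?_⟩
  have hwx : |w x| ≤ 1 := (w.unit_le_opNorm x hx).trans (norm_le_of_mem_clusterFunctionals hf hw)
  have hθu : θ ≤ ‖u - w‖ := by
    have hcl : IsClosed {h | θ ≤ ‖h - w‖} := isClosed_le (by fun_prop) (by fun_prop)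
    exact closure_minimal (fun h hh => hdist h hh w hw) hcl hu
  let D : ℕ → ℝ := fun n => (u - S n) x - q ^ n * w x
  have hD : ∀ n, D (n + 1) = D n - (1 - q) * q ^ n * (g n x - w x) := fun n => by
    simp only [D, hS, sub_apply, add_apply, smul_apply, smul_eq_mul]
    ring
  have hDle : ∀ n, q ^ n * (g n x - w x) ≤ D n + ε n := fun n => by
    have h1 := (S n + q ^ n • g n - w).apply_le_norm hx
    rw [heq _ (subset_closure (hT n)) w hw w₀ hw₀] at h1
    have h2 := h1.trans (hmin n)
    rw [← heq u hu w hw w₀ hw₀, ← hux] at h2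
    simp only [D, sub_apply, add_apply, smul_apply, smul_eq_mul] at h2 ⊢
    linarith
  have hDge : ∀ n, q ^ n * (θ - θ / 4 * (1 - (1 / 2) ^ n)) ≤ D n := by
    intro n
    induction n with
    | zero =>
      simp only [D, hS0, sub_zero, pow_zero, one_mul, sub_self, mul_zero]
      rw [sub_apply] at hux
      rwa [hux]
    | succ n ih =>
      have h1 : (1 - q) * (q ^ n * (g n x - w x)) ≤ (1 - q) * (D n + ε n) :=
        mul_le_mul_of_nonneg_left (hDle n) (by linarith)
      have h2 : q * (q ^ n * (θ - θ / 4 * (1 - (1 / 2) ^ n))) ≤ q * D n := by gcongr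
      have h3 : 0 ≤ q * ε n := by positivity
      have h4 : q ^ (n + 1) * (θ - θ / 4 * (1 - (1 / 2) ^ (n + 1))) =
          q * (q ^ n * (θ - θ / 4 * (1 - (1 / 2) ^ n))) - ε n := by
        simp only [ε]
        ring
      rw [hD, h4]
      linarith
  have hDub : ∀ n, D n ≤ 2 * q ^ n := fun n => by
    have h1 := ((u - S n).apply_le_norm hx).trans (huS n)
    have h2 : q ^ n * -w x ≤ q ^ n * 1 := by
      gcongr
      exact (neg_le_abs _).trans hwx
    simp only [D]
    linarith
  have hgw : ∀ n, w x + θ / 2 ≤ g n x := fun n => by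
    have hqn : 0 < q ^ n := by positivity
    have h1 := hDge n
    have h2 := hDub (n + 1)
    have h3 : (0 : ℝ) < (1 / 2) ^ n := by positivity
    have h4 : q ^ n * (3 / 4 * θ) ≤ q ^ n * (θ - θ / 4 * (1 - (1 / 2) ^ n)) := by
      gcongr
      nlinarith
    have h5 : q ^ n * (θ / 2) ≤ q ^ n * ((1 - q) * (g n x - w x)) := by
      rw [hD, pow_succ] at h2
      have h6 : 2 * (q ^ n * q) = q ^ n * (θ / 4) := by rw [hq]; ring
      linarith
    have h7 := le_of_mul_le_mul_left h5 hqn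
    nlinarith
  have := le_apply_of_mem_clusterFunctionals hwg (.of_forall hgw)
  linarith

/-- **James' theorem**: on a nonreflexive Banach space some functional does not attain its norm. -/
theorem exists_forall_apply_ne_norm_of_not_reflexive [CompleteSpace E]
    (hE : ¬ IsReflexiveSpace E) : ∃ y : StrongDual ℝ E, ∀ x, ‖x‖ ≤ 1 → y x ≠ ‖y‖ := by
  obtain ⟨f, x, hf, hx, hfx, hfx0⟩ := exists_biorthogonal_seq_of_not_reflexive hE
  obtain ⟨φ, hφ, heq⟩ := exists_subseq_norm_sub_eq hf
  refine exists_forall_apply_ne_norm (f := f ∘ φ) (θ := 1 / 2) (fun n => hf _) (by norm_num)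
    (by norm_num) (fun h hh w hw => ?_) fun h hh => heq h (closure_mono ?_ hh)
  -- For large `n`, `x n` separates: `h (x n) ≥ 1/2`, whereas `w (x n) ≤ 0` because `f k` kills `x
  -- n` for all `k > n`.
  · have hconv : Convex ℝ {y : StrongDual ℝ E | ∀ᶠ n in atTop, 1 / 2 ≤ y (x n)} := by
      intro y hy z hz a b ha hb hab
      filter_upwards [hy, hz] with n hyn hzn
      simp only [add_apply, smul_apply, smul_eq_mul]
      calc (1 / 2 : ℝ) = a * (1 / 2) + b * (1 / 2) := by rw [← add_mul, hab, one_mul]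
        _ ≤ a * y (x n) + b * z (x n) := by gcongr
    have hev : ∀ᶠ n in atTop, 1 / 2 ≤ h (x n) := by
      refine convexHull_min ?_ hconv hh
      rintro _ ⟨k, rfl⟩
      filter_upwards [eventually_gt_atTop (φ k)] with n hn
      exact (hfx _ n hn).le
    obtain ⟨n, hn⟩ := hev.exists
    have hwn : w (x n) ≤ 0 := hw (x n) 0 (by
      filter_upwards [hφ.eventually (eventually_gt_atTop n)] with k hk
      exact (hfx0 n _ hk).le)
    have := (h - w).apply_le_norm (hx n)
    rw [sub_apply] at this
    linarith
  · exact (convexHull_mono (Set.range_comp_subset_range φ f)).trans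
      (convexHull_min Submodule.subset_span (Submodule.convex _))

end James

/-! ### The duality map and the zero multifunction -/

namespace Multifunction

variable {E : Type*} [NormedAddCommGroup E] [NormedSpace ℝ E]

theorem not_isSurjective_dualityMap [CompleteSpace E] (hE : ¬ IsReflexiveSpace E) :
    ¬ (dualityMap E).IsSurjective := by
  intro hJ
  obtain ⟨y, hy⟩ := exists_forall_apply_ne_norm_of_not_reflexive hE
  obtain ⟨x, hxy, hyx⟩ : y ∈ (dualityMap E).range := hJ ▸ Set.mem_univ y
  have hn : ‖x‖ = ‖y‖ := (sq_eq_sq₀ (norm_nonneg _) (norm_nonneg _)).1 hxy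
  rcases eq_or_ne ‖y‖ 0 with h0 | h0
  · refine hy 0 (by simp) ?_
    rw [map_zero, h0]
  · refine hy (‖y‖⁻¹ • x) ?_ ?_
    · rw [norm_smul, norm_inv, norm_norm, hn, inv_mul_cancel₀ h0]
    · rw [map_smul, smul_eq_mul, ← hyx, sq, inv_mul_cancel_left₀ h0]

theorem translate_zeroMap (x : E) : (zeroMap E).translate x = zeroMap E := rfl

theorem zeroMap_sum (S : Multifunction E) : (zeroMap E).sum S = S := by
  funext x
  simp [sum, zeroMap]

theorem hasClosedGraph_zeroMap : (zeroMap E).HasClosedGraph :=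
  isClosed_eq continuous_snd continuous_const

theorem isMonotone_zeroMap : (zeroMap E).IsMonotone := by
  rintro ⟨s, _⟩ rfl ⟨t, _⟩ rfl
  simp

theorem isQuasidense_zeroMap : (zeroMap E).IsQuasidense := by
  intro x y
  refine EReal.le_of_forall_lt_iff_le.1 fun ε hε => ?_
  have hε' : 0 < ε := by exact_mod_cast hε
  -- An approximate solution of `y ∈ J z`, available even where no exact one exists; a near-norming
  -- vector is rescaled by `‖y‖`, whence the tolerance `ε / ‖y‖`.
  obtain ⟨z, hz, hyz⟩ : ∃ z : E, ‖z‖ ≤ ‖y‖ ∧ ‖y‖ ^ 2 - ε ≤ y z := by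
    rcases eq_or_ne ‖y‖ 0 with h0 | h0
    · exact ⟨0, by simp, by simp [h0, hε'.le]⟩
    · have hy : 0 < ‖y‖ := (norm_nonneg y).lt_of_ne' h0
      obtain ⟨z, hz, hyz⟩ := y.exists_lt_apply_of_lt_norm (sub_lt_self ‖y‖ (div_pos hε' hy))
      refine ⟨‖y‖ • z, ?_, ?_⟩
      · rw [norm_smul, norm_norm]
        exact mul_le_of_le_one_right hy.le hz
      · rw [map_smul, smul_eq_mul]
        have := mul_le_mul_of_nonneg_left hyz.le hy.le
        rwa [mul_sub, mul_div_cancel₀ _ h0, ← sq] at this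
  refine (iInf₂_le (α := EReal) (x + z, (0 : StrongDual ℝ E))
    (show _ ∈ (zeroMap E).graph from Set.mem_singleton _)).trans ?_
  refine EReal.coe_le_coe_iff.2 ?_
  have h2 : ‖z‖ ^ 2 ≤ ‖y‖ ^ 2 := by gcongr
  simp only [add_sub_cancel_left, zero_sub, norm_neg, neg_apply]
  linarith

end Multifunction

theorem mainTheorem3 {E : Type*} [NormedAddCommGroup E] [NormedSpace ℝ E] [CompleteSpace E]
    (hE : ¬ IsReflexiveSpace E) :
    -- the duality map is not surjective
    ¬ (Multifunction.dualityMap E).IsSurjective ∧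
    -- no translate of `S = 0` becomes surjective after adding the duality map
    (∀ x : E, (Multifunction.zeroMap E).translate x = Multifunction.zeroMap E ∧
      ¬ (((Multifunction.zeroMap E).translate x).sum
          (Multifunction.dualityMap E)).IsSurjective) ∧
    -- although `S = 0` is closed, monotone and quasidense
    (Multifunction.zeroMap E).HasClosedGraph ∧
    (Multifunction.zeroMap E).IsMonotone ∧
    (Multifunction.zeroMap E).IsQuasidense ∧
    -- so the surjectivity assertion known for reflexive spaces fails on `E`
    ¬ (∀ S : Multifunction E, S.graph.Nonempty → S.HasClosedGraph → S.IsMonotone →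
        S.IsQuasidense → ∀ x : E,
          ((S.translate x).sum (Multifunction.dualityMap E)).IsSurjective) := by
  have hJ := Multifunction.not_isSurjective_dualityMap hE
  have hJ' : ∀ x : E, ¬ (((Multifunction.zeroMap E).translate x).sum
      (Multifunction.dualityMap E)).IsSurjective := fun x => by
    rwa [Multifunction.translate_zeroMap, Multifunction.zeroMap_sum]
  exact ⟨hJ, fun x => ⟨Multifunction.translate_zeroMap x, hJ' x⟩,
    Multifunction.hasClosedGraph_zeroMap, Multifunction.isMonotone_zeroMap,
    Multifunction.isQuasidense_zeroMap, fun h => hJ' 0 (h _ ⟨(0, 0), Set.mem_singleton _⟩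
      Multifunction.hasClosedGraph_zeroMap Multifunction.isMonotone_zeroMap
      Multifunction.isQuasidense_zeroMap 0)⟩
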